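/- Let $K$ be a field of characteristic zero (for instance $\mathbb{Q}$ or $\mathbb{C}$). For an integer $k\ge 0$ let $C_k=\frac{1}{k+1}\binom{2k}{k}$ be the $k$-th Catalan number and let $H_k^{(2)}=\sum_{j=1}^{k}1/j^2$. For $d\ge 1$ let $\mathrm{Li}_d(x)=\sum_{k\ge 1}x^k/k^d\in K[[x]]$, and let $$\beta=\sum_{k\ge 0}C_k x^{k+1}=\frac{1-\sqrt{1-4x}}{2}\in K[[x]],$$ where $\sqrt{1-4x}$ is the formal square root with constant coefficient $1$. As $\beta$ has zero constant coefficient, the series $\mathrm{Li}_d(\beta)$ is well defined in $K[[x]]$, and $1-2\beta$ is invertible in $K[[x]]$. Then the following identities hold in $K[[x]]$: $$\sum_{k\ge 1}\binom{2k}{k}H_k^{(2)}x^k=\frac{2\,\mathrm{Li}_2(\beta)+\mathrm{Li}_1(\beta)^2}{1-2\beta},$$ $$\sum_{k\ge 1}C_k H_k^{(2)}x^{k+1}=2\beta\,\mathrm{Li}_2(\beta)-(1-\beta)\,\mathrm{Li}_1(\beta)^2.$$ -/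

import Mathlib

open PowerSeries

/-- The formal power series `∑_{k ≥ 1} a k * x ^ k`. -/
def seriesFromOne {K : Type*} [Field K] (a : ℕ → K) : PowerSeries K :=
  PowerSeries.mk fun k => if k = 0 then 0 else a k

/-- The generalized harmonic number `H_k^{(d)} = ∑_{j=1}^k 1 / j ^ d`. -/
def genHarmonic (K : Type*) [Field K] (d k : ℕ) : K :=
  ∑ j ∈ Finset.Icc 1 k, 1 / (j : K) ^ d

/-- The polylogarithm `Li_d(x) = ∑_{k ≥ 1} x ^ k / k ^ d` as a formal power series. -/
def polylogSeries (K : Type*) [Field K] (d : ℕ) : PowerSeries K :=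
  seriesFromOne fun k => 1 / (k : K) ^ d

/-- The series `β = ∑_{k ≥ 0} C_k * x ^ (k + 1)`, with `C_k` the Catalan numbers. -/
noncomputable def catalanBeta (K : Type*) [Field K] : PowerSeries K :=
  PowerSeries.X * PowerSeries.mk fun k => (catalan k : K)

theorem constantCoeff_catalanBeta (K : Type*) [Field K] :
    PowerSeries.constantCoeff (catalanBeta K) = 0 := by
  simp [catalanBeta]

/-- As `β` has constant coefficient zero, it may be substituted into any power series. -/
theorem hasSubst_catalanBeta (K : Type*) [Field K] :
    PowerSeries.HasSubst (catalanBeta K) :=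
  PowerSeries.HasSubst.of_constantCoeff_zero' (constantCoeff_catalanBeta K)

theorem catalanBeta_mul_one_sub (K : Type*) [Field K] :
    catalanBeta K * (1 - catalanBeta K) = PowerSeries.X := by
  have h := congrArg (PowerSeries.map (Nat.castRingHom K))
    PowerSeries.catalanSeries_sq_mul_X_add_one
  have e : PowerSeries.map (Nat.castRingHom K) PowerSeries.catalanSeries =
      PowerSeries.mk fun k => (catalan k : K) := by
    ext n
    simp
  simp only [map_add, map_mul, map_pow, map_one, PowerSeries.map_X, e] at h
  rw [catalanBeta]
  linear_combination (-PowerSeries.X) * h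

/-- `β = (1 - √(1 - 4x)) / 2`: in characteristic zero, if `s` is the formal square root of
`1 - 4x` with constant coefficient `1`, then `β = (1 - s) / 2`. -/
theorem catalanBeta_eq_sqrt (K : Type*) [Field K] [CharZero K] (s : PowerSeries K)
    (hs : s ^ 2 = 1 - 4 * PowerSeries.X) (h1 : PowerSeries.constantCoeff s = 1) :
    catalanBeta K = PowerSeries.C (1 / 2 : K) * (1 - s) := by
  have hb : (1 - 2 * catalanBeta K) ^ 2 = s ^ 2 := by
    rw [hs]
    linear_combination (-4) * catalanBeta_mul_one_sub K
  have h2 : PowerSeries.C (1 / 2 : K) * 2 = 1 := by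
    rw [← map_ofNat (PowerSeries.C (R := K)) 2, ← map_mul]
    simp
  rcases sq_eq_sq_iff_eq_or_eq_neg.mp hb with h | h
  · linear_combination (-PowerSeries.C (1 / 2 : K)) * h - catalanBeta K * h2
  · have := congrArg PowerSeries.constantCoeff h
    simp only [map_sub, map_mul, map_neg, map_one, constantCoeff_catalanBeta, h1] at this
    norm_num at this

/-! In characteristic zero a power series is determined by its derivative and constant coefficient,
so each identity is checked by differentiating. From `β(1 - β) = x` come `(1 - 2β)β' = 1` and `(1 -
2β)² = 1 - 4x`. The central binomial recurrence gives a first-order linear ODE for `A = ∑ binom(2k,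
k) H_k^{(2)} x^k`, with integrating factor `1 - 2β` and source `2 Li_1(β) / x`. The Catalan series
is an antiderivative of `A`. -/

theorem seriesFromOne_eq_mk {K : Type*} [Field K] {a : ℕ → K} (h : a 0 = 0) :
    seriesFromOne a = PowerSeries.mk a := by
  ext n
  rcases n with _ | n <;> simp [seriesFromOne, h]

theorem constantCoeff_seriesFromOne {K : Type*} [Field K] (a : ℕ → K) :
    constantCoeff (seriesFromOne a) = 0 := by
  rw [← coeff_zero_eq_constantCoeff_apply]
  simp [seriesFromOne]

theorem genHarmonic_zero (K : Type*) [Field K] (d : ℕ) : genHarmonic K d 0 = 0 := by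
  simp [genHarmonic]

theorem genHarmonic_succ (K : Type*) [Field K] (d k : ℕ) :
    genHarmonic K d (k + 1) = genHarmonic K d k + 1 / ((k : K) + 1) ^ d := by
  simp [genHarmonic, Finset.sum_Icc_succ_top]

theorem derivative_two (K : Type*) [Field K] : d⁄dX K (2 : PowerSeries K) = 0 := by
  rw [← map_ofNat (C (R := K)) 2, derivative_C]

/-- The chain rule for `f(β)`. -/
theorem derivative_subst_catalanBeta {K : Type*} [Field K] (f : PowerSeries K) :
    d⁄dX K (f.subst (catalanBeta K) : PowerSeries K) =
      (d⁄dX K f).subst (catalanBeta K) * d⁄dX K (catalanBeta K) :=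
  derivative_subst (hasSubst_catalanBeta K)

theorem constantCoeff_polylogSeries_subst_catalanBeta (K : Type*) [Field K] (d : ℕ) :
    constantCoeff ((polylogSeries K d).subst (catalanBeta K) : PowerSeries K) = 0 :=
  constantCoeff_subst_eq_zero (constantCoeff_catalanBeta K) _ (constantCoeff_seriesFromOne _)

/-- `x * Li_{d+1}'(x) = Li_d(x)`. -/
theorem X_mul_derivative_polylogSeries_succ (K : Type*) [Field K] [CharZero K] (d : ℕ) :
    X * d⁄dX K (polylogSeries K (d + 1)) = polylogSeries K d := by
  ext n
  rcases n with _ | n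
  · simp [polylogSeries, seriesFromOne]
  · have h : (n : K) + 1 ≠ 0 := by exact_mod_cast n.succ_ne_zero
    rw [coeff_succ_X_mul, coeff_derivative]
    simp only [polylogSeries, seriesFromOne, coeff_mk, if_neg n.succ_ne_zero]
    push_cast
    field_simp
    ring

/-- `(1 - x) * Li_1'(x) = 1`. -/
theorem one_sub_X_mul_derivative_polylogSeries_one (K : Type*) [Field K] [CharZero K] :
    (1 - X) * d⁄dX K (polylogSeries K 1) = 1 := by
  have e : d⁄dX K (polylogSeries K 1) = PowerSeries.mk 1 := by
    ext n
    have h : (n : K) + 1 ≠ 0 := by exact_mod_cast n.succ_ne_zero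
    rw [coeff_derivative]
    simp only [polylogSeries, seriesFromOne, coeff_mk, if_neg n.succ_ne_zero]
    push_cast
    simp [h]
  rw [e, mul_comm]
  exact mk_one_mul_one_sub_eq_one K

theorem catalanBeta_mul_derivative_polylogSeries_succ_subst (K : Type*) [Field K] [CharZero K]
    (d : ℕ) :
    catalanBeta K * d⁄dX K ((polylogSeries K (d + 1)).subst (catalanBeta K) : PowerSeries K) =
      (polylogSeries K d).subst (catalanBeta K) * d⁄dX K (catalanBeta K) := by
  rw [derivative_subst_catalanBeta, ← X_mul_derivative_polylogSeries_succ K d,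
    subst_mul (hasSubst_catalanBeta K), subst_X (hasSubst_catalanBeta K), mul_assoc]

theorem one_sub_catalanBeta_mul_derivative_polylogSeries_one_subst
    (K : Type*) [Field K] [CharZero K] :
    (1 - catalanBeta K) *
        d⁄dX K ((polylogSeries K 1).subst (catalanBeta K) : PowerSeries K) =
      d⁄dX K (catalanBeta K) := by
  have h := congrArg (substAlgHom (R := K) (hasSubst_catalanBeta K))
    (one_sub_X_mul_derivative_polylogSeries_one K)
  rw [map_mul, map_sub, map_one, substAlgHom_X, coe_substAlgHom] at h
  rw [derivative_subst_catalanBeta, ← mul_assoc, h, one_mul]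

/-- `(1 - 2β) * β' = 1`. -/
theorem one_sub_two_mul_catalanBeta_mul_derivative (K : Type*) [Field K] :
    (1 - 2 * catalanBeta K) * d⁄dX K (catalanBeta K) = 1 := by
  have h := congrArg (d⁄dX K) (catalanBeta_mul_one_sub K)
  simp only [Derivation.leibniz, map_sub, derivative_one, derivative_X, smul_eq_mul] at h
  linear_combination h

/-- `β'` is the generating series of the central binomial coefficients. -/
theorem derivative_catalanBeta (K : Type*) [Field K] :
    d⁄dX K (catalanBeta K) = PowerSeries.mk fun k => (k.centralBinom : K) := by
  ext n
  rw [coeff_derivative, catalanBeta, coeff_succ_X_mul, coeff_mk, coeff_mk,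
    ← succ_mul_catalan_eq_centralBinom]
  push_cast
  ring

/-- `∑_{k ≥ 1} binom(2k, k) x ^ k / k = 2 Li_1(β)`. -/
theorem X_mul_mk_centralBinom_succ_div (K : Type*) [Field K] [CharZero K] :
    X * PowerSeries.mk (fun k => ((k + 1).centralBinom : K) / ((k : K) + 1)) =
      2 * (polylogSeries K 1).subst (catalanBeta K) := by
  refine derivative.ext ?_ ?_
  · have hX : X * d⁄dX K (X * PowerSeries.mk
        (fun k => ((k + 1).centralBinom : K) / ((k : K) + 1))) =
        d⁄dX K (catalanBeta K) - 1 := by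
      rw [derivative_catalanBeta]
      ext n
      rcases n with _ | n
      · simp
      · have h : (n : K) + 1 ≠ 0 := by exact_mod_cast n.succ_ne_zero
        rw [coeff_succ_X_mul, coeff_derivative, coeff_succ_X_mul, map_sub, coeff_mk, coeff_mk,
          coeff_one, if_neg n.succ_ne_zero, sub_zero, div_mul_cancel₀ _ h]
    -- With `x = β(1 - β)`, both sides become `2ββ' = β' - 1`.
    refine mul_left_cancel₀ (X_ne_zero (R := K)) ?_
    rw [hX, Derivation.leibniz, derivative_two, smul_zero, add_zero, smul_eq_mul,
      ← catalanBeta_mul_one_sub K]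
    linear_combination (-2 * catalanBeta K) *
      one_sub_catalanBeta_mul_derivative_polylogSeries_one_subst K +
      one_sub_two_mul_catalanBeta_mul_derivative K
  · simp [constantCoeff_polylogSeries_subst_catalanBeta]

/-- The differential equation of `∑_{k ≥ 1} binom(2k, k) H_k^{(2)} x ^ k`. -/
theorem derivative_mk_centralBinom_mul_genHarmonic (K : Type*) [Field K] [CharZero K] :
    (1 - 4 * X) * d⁄dX K (PowerSeries.mk fun k => (k.centralBinom : K) * genHarmonic K 2 k) =
      2 * (PowerSeries.mk fun k => (k.centralBinom : K) * genHarmonic K 2 k) +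
        PowerSeries.mk (fun k => ((k + 1).centralBinom : K) / ((k : K) + 1)) := by
  ext n
  have h : (n : K) + 1 ≠ 0 := by exact_mod_cast n.succ_ne_zero
  have hb : ((n : K) + 1) * (n + 1).centralBinom = 2 * (2 * n + 1) * n.centralBinom := by
    exact_mod_cast n.succ_mul_centralBinom_succ
  have hX : coeff n (X * d⁄dX K (PowerSeries.mk fun k =>
      (k.centralBinom : K) * genHarmonic K 2 k)) =
      n * ((n.centralBinom : K) * genHarmonic K 2 n) := by
    rcases n with _ | n
    · simp
    · rw [coeff_succ_X_mul, coeff_derivative, coeff_mk]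
      push_cast
      ring
  rw [sub_mul, one_mul, mul_assoc, ← map_ofNat (C (R := K)) 4, ← map_ofNat (C (R := K)) 2,
    map_sub, map_add, coeff_C_mul, coeff_C_mul, hX, coeff_derivative]
  -- The `H_n` part cancels by `hb`; the increment `1 / (n + 1)²` produces the source term.
  simp only [coeff_mk, genHarmonic_succ]
  field_simp
  linear_combination genHarmonic K 2 n * ((n : K) + 1) * hb

theorem mk_centralBinom_mul_genHarmonic_mul (K : Type*) [Field K] [CharZero K] :
    (1 - 2 * catalanBeta K) *
        (PowerSeries.mk fun k => (k.centralBinom : K) * genHarmonic K 2 k) =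
      2 * (polylogSeries K 2).subst (catalanBeta K) +
        (polylogSeries K 1).subst (catalanBeta K) ^ 2 := by
  have hode := derivative_mk_centralBinom_mul_genHarmonic K
  have hQ := X_mul_mk_centralBinom_succ_div K
  have hb := one_sub_two_mul_catalanBeta_mul_derivative K
  have hX := catalanBeta_mul_one_sub K
  have h1 := one_sub_catalanBeta_mul_derivative_polylogSeries_one_subst K
  have h2 := catalanBeta_mul_derivative_polylogSeries_succ_subst K 1
  have hc1 := constantCoeff_polylogSeries_subst_catalanBeta K 1
  have hc2 := constantCoeff_polylogSeries_subst_catalanBeta K 2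
  norm_num only at h2
  set b := catalanBeta K
  set A := PowerSeries.mk fun k => (k.centralBinom : K) * genHarmonic K 2 k with hA
  set B := PowerSeries.mk fun k => ((k + 1).centralBinom : K) / ((k : K) + 1)
  set L : PowerSeries K := (polylogSeries K 1).subst b
  set M : PowerSeries K := (polylogSeries K 2).subst b
  refine derivative.ext ?_ ?_
  · have hs : X * (1 - 2 * b) ≠ 0 := by
      refine mul_ne_zero X_ne_zero fun h => ?_
      rw [h, zero_mul] at hb
      exact zero_ne_one hb
    refine mul_left_cancel₀ hs ?_
    have e : (1 - 2 * b) ^ 2 = 1 - 4 * X := by linear_combination (-4) * hX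
    simp only [map_add, map_sub, Derivation.leibniz, Derivation.leibniz_pow, derivative_one,
      smul_eq_mul, derivative_two]
    have lhs : (1 - 2 * b) * ((1 - 2 * b) * d⁄dX K A - 2 * A * d⁄dX K b) = B := by
      linear_combination d⁄dX K A * e + hode - 2 * A * hb
    -- Since `X = b(1 - b)`, the two terms are `2(1 - b)Lb'` and `2bLb'`.
    have rhs : X * (2 * d⁄dX K M + 2 * L * d⁄dX K L) = 2 * L * d⁄dX K b := by
      linear_combination (-(2 * d⁄dX K M + 2 * L * d⁄dX K L)) * hX +
        2 * (1 - b) * h2 + 2 * L * b * h1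
    simp only [nsmul_eq_mul, Nat.cast_ofNat]
    linear_combination X * lhs + hQ - (1 - 2 * b) * rhs - 2 * L * hb
  · have hcA : constantCoeff A = 0 := by
      rw [← coeff_zero_eq_constantCoeff_apply, hA, coeff_mk, genHarmonic_zero, mul_zero]
    simp [hcA, hc1, hc2]

/-- Differentiation brings down `k + 1`, and `(k + 1) C_k = binom(2k, k)`. -/
theorem derivative_X_mul_mk_catalan_mul_genHarmonic (K : Type*) [Field K] :
    d⁄dX K (X * PowerSeries.mk fun k => (catalan k : K) * genHarmonic K 2 k) =
      PowerSeries.mk fun k => (k.centralBinom : K) * genHarmonic K 2 k := by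
  ext n
  rw [coeff_derivative, coeff_succ_X_mul, coeff_mk, coeff_mk, ← succ_mul_catalan_eq_centralBinom]
  push_cast
  ring

theorem X_mul_mk_catalan_mul_genHarmonic (K : Type*) [Field K] [CharZero K] :
    X * (PowerSeries.mk fun k => (catalan k : K) * genHarmonic K 2 k) =
      2 * catalanBeta K * (polylogSeries K 2).subst (catalanBeta K) -
        (1 - catalanBeta K) * (polylogSeries K 1).subst (catalanBeta K) ^ 2 := by
  refine derivative.ext ?_ ?_
  · rw [derivative_X_mul_mk_catalan_mul_genHarmonic]
    have hA := mk_centralBinom_mul_genHarmonic_mul K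
    have hb := one_sub_two_mul_catalanBeta_mul_derivative K
    have h1 := one_sub_catalanBeta_mul_derivative_polylogSeries_one_subst K
    have h2 := catalanBeta_mul_derivative_polylogSeries_succ_subst K 1
    norm_num only at h2
    simp only [map_sub, Derivation.leibniz, Derivation.leibniz_pow, derivative_one,
      smul_eq_mul, derivative_two, nsmul_eq_mul, Nat.cast_ofNat]
    set A := PowerSeries.mk fun k => (k.centralBinom : K) * genHarmonic K 2 k
    -- The terms `±2 Li_1(β)β'` cancel, leaving `β'(2 Li_2(β) + Li_1(β)²)`, which is `A` because `β'
    -- = 1 / (1 - 2β)`.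
    linear_combination d⁄dX K (catalanBeta K) * hA - A * hb - 2 * h2 +
      2 * (polylogSeries K 1).subst (catalanBeta K) * h1
  · simp [constantCoeff_polylogSeries_subst_catalanBeta]

theorem mainTheorem4 (K : Type*) [Field K] [CharZero K] :
    seriesFromOne (fun k => (Nat.choose (2 * k) k : K) * genHarmonic K 2 k) =
        (2 * (polylogSeries K 2).subst (catalanBeta K) +
          (polylogSeries K 1).subst (catalanBeta K) ^ 2) * (1 - 2 * catalanBeta K)⁻¹ ∧
      PowerSeries.X * seriesFromOne (fun k => (catalan k : K) * genHarmonic K 2 k) =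
        2 * catalanBeta K * (polylogSeries K 2).subst (catalanBeta K) -
          (1 - catalanBeta K) * (polylogSeries K 1).subst (catalanBeta K) ^ 2 := by
  rw [seriesFromOne_eq_mk (by simp [genHarmonic_zero]),
    seriesFromOne_eq_mk (by simp [genHarmonic_zero])]
  refine ⟨?_, X_mul_mk_catalan_mul_genHarmonic K⟩
  rw [PowerSeries.eq_mul_inv_iff_mul_eq (by simp [constantCoeff_catalanBeta]), mul_comm]
  exact mk_centralBinom_mul_genHarmonic_mul K
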